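/- Let $X$ be a topological space. A family $\mathcal F$ of compact subsets of $X$ is called \emph{functionally distinguished} if it contains all singletons, is closed under passing to compact subsets and under finite unions (including the empty union, so $\emptyset\in\mathcal F$), and a function $f:X\to\mathbb R$ is continuous if and only if $f|_K$ is continuous for every $K\in\mathcal F$. Let $\mathcal T$ be the category whose objects are pairs $(X,\mathcal F)$ with $X$ a Tychonoff space and $\mathcal F$ a functionally distinguished family of compact subsets of $X$, and whose morphisms $(X,\mathcal F)\to(Y,\mathcal G)$ are the continuous maps $f:X\to Y$ with $f(K)\in\mathcal G$ for all $K\in\mathcal F$. A \emph{pro-$C^*$-algebra} is a complete Hausdorff topological $*$-algebra over $\mathbb C$ whose topology is defined by its continuous $C^*$-seminorms (equivalently, a cofiltered limit of $C^*$-algebras in the category of topological $*$-algebras). Let $\mathcal A$ be the category of unital commutative pro-$C^*$-algebras (the zero algebra included) and continuous unital $*$-homomorphisms. For $(X,\mathcal F)\in\mathcal T$ let ${}_{\mathcal F}C(X)$ be the $*$-algebra of all continuous functions $X\to\mathbb C$ with the topology of uniform convergence on the members of $\mathcal F$; it is a unital commutative pro-$C^*$-algebra. Then the contravariant functor $$\mathcal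 T^{\mathrm{op}}\longrightarrow\mathcal A,\qquad (X,\mathcal F)\longmapsto {}_{\mathcal F}C(X),\qquad f\longmapsto (g\mapsto g\circ f),$$ is an equivalence of categories. -/

import Mathlib

universe u

/-! ### Tychonoff spaces with functionally distinguished families of compact sets -/

/-- A family `𝓕` of compact subsets of a topological space `X` is functionally distinguished if it
contains the singletons, is closed under passing to compact subsets and under finite unions
(in particular it contains the empty set, the union of no sets), and determines the real-valued
continuous functions on `X`. -/
structure IsFunctionallyDistinguished {X : Type*} [TopologicalSpace X] (𝓕 : Set (Set X)) :
    Prop where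
  isCompact : ∀ K ∈ 𝓕, IsCompact K
  singleton_mem : ∀ x : X, {x} ∈ 𝓕
  mem_of_subset : ∀ K ∈ 𝓕, ∀ L ⊆ K, IsCompact L → L ∈ 𝓕
  sUnion_mem : ∀ S ⊆ 𝓕, S.Finite → ⋃₀ S ∈ 𝓕
  continuous_iff : ∀ f : X → ℝ, Continuous f ↔ ∀ K ∈ 𝓕, ContinuousOn f K

/-- Tychonoff spaces equipped with a functionally distinguished family of compact subsets. -/
structure FDTych : Type (u + 1) where
  carrier : Type u
  [topologicalSpace : TopologicalSpace carrier]
  [t35Space : T35Space carrier]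
  family : Set (Set carrier)
  isFunctionallyDistinguished : IsFunctionallyDistinguished family

namespace FDTych

attribute [instance] FDTych.topologicalSpace FDTych.t35Space

/-- Morphisms `(X, 𝓕) ⟶ (Y, 𝓖)`: continuous maps `X → Y` that send members of `𝓕` to members
of `𝓖`. -/
@[ext]
structure Hom (X Y : FDTych.{u}) : Type u where
  toContinuousMap : C(X.carrier, Y.carrier)
  image_mem : ∀ K ∈ X.family, toContinuousMap '' K ∈ Y.family

instance : CategoryTheory.Category FDTych.{u} where
  Hom X Y := Hom X Y
  id X := ⟨ContinuousMap.id _, fun K hK => by simpa using hK⟩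
  comp f g := ⟨g.toContinuousMap.comp f.toContinuousMap, fun K hK => by
    have h := g.image_mem _ (f.image_mem K hK)
    rwa [← Set.image_comp] at h⟩

end FDTych

/-! ### Commutative unital pro-C⋆-algebras -/

/-- A C⋆-seminorm on a complex ⋆-algebra. -/
structure IsCStarSeminorm {A : Type*} [Ring A] [StarRing A] [Algebra ℂ A]
    (p : Seminorm ℂ A) : Prop where
  map_mul_le : ∀ a b : A, p (a * b) ≤ p a * p b
  map_star_mul_self : ∀ a : A, p (star a * a) = p a * p a

/-- A unital complex ⋆-algebra with a uniform structure is a pro-C⋆-algebra if it is a complete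
Hausdorff topological ⋆-algebra (the uniformity being the one of its additive topological group)
whose topology is the one defined by all its continuous C⋆-seminorms. -/
class IsProCStarAlgebra (A : Type*) [Ring A] [StarRing A] [Algebra ℂ A] [StarModule ℂ A]
    [UniformSpace A] : Prop where
  isUniformAddGroup : IsUniformAddGroup A
  isTopologicalRing : IsTopologicalRing A
  continuousStar : ContinuousStar A
  continuousSMul : ContinuousSMul ℂ A
  t2Space : T2Space A
  completeSpace : CompleteSpace A
  withSeminorms : WithSeminorms
    (fun p : {p : Seminorm ℂ A // IsCStarSeminorm p ∧ Continuous p} => (p : Seminorm ℂ A))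

/-- Unital commutative pro-C⋆-algebras. -/
structure CommProCStarAlg : Type (u + 1) where
  carrier : Type u
  [commRing : CommRing carrier]
  [starRing : StarRing carrier]
  [algebra : Algebra ℂ carrier]
  [starModule : StarModule ℂ carrier]
  [uniformSpace : UniformSpace carrier]
  [isProCStarAlgebra : IsProCStarAlgebra carrier]

namespace CommProCStarAlg

attribute [instance] CommProCStarAlg.commRing CommProCStarAlg.starRing CommProCStarAlg.algebra
  CommProCStarAlg.starModule CommProCStarAlg.uniformSpace CommProCStarAlg.isProCStarAlgebra

/-- Morphisms of unital pro-C⋆-algebras: continuous unital ⋆-homomorphisms. -/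
@[ext]
structure Hom (A B : CommProCStarAlg.{u}) : Type u where
  toStarAlgHom : A.carrier →⋆ₐ[ℂ] B.carrier
  continuous : Continuous toStarAlgHom

instance : CategoryTheory.Category CommProCStarAlg.{u} where
  Hom A B := Hom A B
  id A := ⟨StarAlgHom.id ℂ _, continuous_id⟩
  comp f g := ⟨g.toStarAlgHom.comp f.toStarAlgHom, g.continuous.comp f.continuous⟩

end CommProCStarAlg

/-! ### Continuous functions with the topology of uniform convergence on a family of sets -/

/-- For `X = (X, 𝓕)`, the ⋆-algebra `C(X, ℂ)` of continuous complex-valued functions on `X`, to be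
equipped with the topology of uniform convergence on members of `𝓕` (not with the compact-open
topology). -/
def FamilyCont (X : FDTych.{u}) : Type u := C(X.carrier, ℂ)

namespace FamilyCont

noncomputable section

variable (X : FDTych.{u})

instance : CommRing (FamilyCont X) := inferInstanceAs (CommRing C(X.carrier, ℂ))

instance : StarRing (FamilyCont X) := inferInstanceAs (StarRing C(X.carrier, ℂ))

instance : Algebra ℂ (FamilyCont X) := inferInstanceAs (Algebra ℂ C(X.carrier, ℂ))

instance : StarModule ℂ (FamilyCont X) := inferInstanceAs (StarModule ℂ C(X.carrier, ℂ))

/-- The function underlying an element of `FamilyCont X`, in Mathlib's space of functions with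
the uniformity of uniform convergence on members of the family of `X`. -/
def toUniformOnFun (f : FamilyCont X) : UniformOnFun X.carrier ℂ X.family :=
  UniformOnFun.ofFun X.family (show C(X.carrier, ℂ) from f)

/-- The uniformity of uniform convergence on members of the family. -/
instance : UniformSpace (FamilyCont X) :=
  UniformSpace.comap (toUniformOnFun X) inferInstance

variable {X}

/-- Restriction of functions to a subset, as a ⋆-homomorphism. -/
def restrict (K : Set X.carrier) : FamilyCont X →⋆ₐ[ℂ] C(K, ℂ) :=
  ContinuousMap.compStarAlgHom' ℂ ℂ (ContinuousMap.mk (Subtype.val : K → X.carrier))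

theorem toUniformOnFun_injective : Function.Injective (toUniformOnFun X) := by
  intro f g h
  exact DFunLike.coe_injective (F := C(X.carrier, ℂ)) h

theorem compactSpace_of_mem {K : Set X.carrier} (hK : K ∈ X.family) : CompactSpace K :=
  isCompact_iff_compactSpace.mp (X.isFunctionallyDistinguished.isCompact K hK)

theorem uniformSpace_eq :
    (inferInstance : UniformSpace (FamilyCont X)) =
      ⨅ K : X.family, UniformSpace.comap (restrict K.1) inferInstance := by
  change UniformSpace.comap (toUniformOnFun X) (⨅ s ∈ X.family, _) = _
  rw [UniformSpace.comap_iInf, iInf_subtype]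
  refine iInf_congr fun K => ?_
  rw [UniformSpace.comap_iInf]
  refine iInf_congr fun hK => ?_
  have := compactSpace_of_mem hK
  have e : (inferInstance : UniformSpace C(K, ℂ)) =
      UniformSpace.comap (fun f : C(K, ℂ) => UniformFun.ofFun (f : K → ℂ)) inferInstance :=
    (ContinuousMap.isUniformEmbedding_uniformFunOfFun (α := K) (β := ℂ)).comap_uniformSpace.symm
  rw [e, ← UniformSpace.comap_comap, ← UniformSpace.comap_comap]
  rfl

theorem topology_eq :
    (inferInstance : TopologicalSpace (FamilyCont X)) =
      ⨅ K : X.family, TopologicalSpace.induced (restrict K.1) inferInstance := by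
  have h := congrArg (fun u => @UniformSpace.toTopologicalSpace (FamilyCont X) u)
    (uniformSpace_eq (X := X))
  refine h.trans ?_
  rw [UniformSpace.toTopologicalSpace_iInf]
  rfl

theorem continuous_rng_iff {Z : Type*} [TopologicalSpace Z] {f : Z → FamilyCont X} :
    Continuous f ↔ ∀ K ∈ X.family, Continuous (fun z => restrict K (f z)) := by
  have h := topology_eq (X := X)
  rw [show Continuous f ↔ @Continuous Z (FamilyCont X) _
    (⨅ K : X.family, TopologicalSpace.induced (restrict K.1) inferInstance) f from
    by rw [← h]]
  simp only [continuous_iInf_rng, continuous_induced_rng, Subtype.forall]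
  rfl

theorem continuous_restrict {K : Set X.carrier} (hK : K ∈ X.family) :
    Continuous (restrict (X := X) K) :=
  continuous_rng_iff.mp continuous_id K hK

instance : IsUniformAddGroup (FamilyCont X) :=
  let φ : FamilyCont X →+ UniformOnFun X.carrier ℂ X.family :=
    { toFun := toUniformOnFun X
      map_zero' := rfl
      map_add' := fun _ _ => rfl }
  IsUniformAddGroup.comap φ

instance : IsTopologicalRing (FamilyCont X) where
  continuous_mul := continuous_rng_iff.mpr fun K hK => by
    have := compactSpace_of_mem hK
    simp only [map_mul]
    exact ((continuous_restrict hK).comp continuous_fst).mul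
      ((continuous_restrict hK).comp continuous_snd)

instance : ContinuousStar (FamilyCont X) where
  continuous_star := continuous_rng_iff.mpr fun K hK => by
    have := compactSpace_of_mem hK
    simp only [map_star]
    exact (continuous_restrict hK).star

instance : ContinuousSMul ℂ (FamilyCont X) where
  continuous_smul := continuous_rng_iff.mpr fun K hK => by
    simp only [map_smul]
    exact continuous_fst.smul ((continuous_restrict hK).comp continuous_snd)

theorem sUnion_family : ⋃₀ X.family = Set.univ :=
  Set.eq_univ_of_forall fun x =>
    ⟨{x}, X.isFunctionallyDistinguished.singleton_mem x, rfl⟩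

instance : T2Space (FamilyCont X) := by
  have := UniformOnFun.t2Space_of_covering (α := X.carrier) (β := ℂ) sUnion_family
  exact T2Space.of_injective_continuous toUniformOnFun_injective continuous_induced_dom

theorem continuous_of_continuousOn {f : X.carrier → ℂ} (h : ∀ K ∈ X.family, ContinuousOn f K) :
    Continuous f := by
  have hre : Continuous fun x => (f x).re :=
    (X.isFunctionallyDistinguished.continuous_iff _).mpr fun K hK =>
      Complex.continuous_re.comp_continuousOn (h K hK)
  have him : Continuous fun x => (f x).im :=
    (X.isFunctionallyDistinguished.continuous_iff _).mpr fun K hK =>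
      Complex.continuous_im.comp_continuousOn (h K hK)
  have e : f = fun x => ((f x).re : ℂ) + ((f x).im : ℂ) * Complex.I :=
    funext fun x => (Complex.re_add_im (f x)).symm
  rw [e]
  fun_prop

instance : CompleteSpace (FamilyCont X) := by
  have hind : IsUniformInducing (toUniformOnFun X) := ⟨rfl⟩
  rw [completeSpace_iff_isComplete_range hind]
  refine IsClosed.isComplete ?_
  have : Set.range (toUniformOnFun X) =
      {f | ∀ K ∈ X.family, ContinuousOn (UniformOnFun.toFun X.family f) K} := by
    ext f
    constructor
    · rintro ⟨g, rfl⟩ K _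
      exact (ContinuousMap.continuous (show C(X.carrier, ℂ) from g)).continuousOn
    · intro h
      exact ⟨(⟨_, continuous_of_continuousOn h⟩ : C(X.carrier, ℂ)), rfl⟩
  rw [this]
  refine isClosed_iff_forall_filter.2 fun f u _ hu huf K hK => ?_
  rw [← Filter.tendsto_id', UniformOnFun.tendsto_iff_tendstoUniformlyOn] at huf
  exact (huf K hK).continuousOn
    (Filter.Eventually.frequently (hu fun g hg => hg K hK))

theorem withSeminorms : WithSeminorms
    (fun p : {p : Seminorm ℂ (FamilyCont X) // IsCStarSeminorm p ∧ Continuous p} =>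
      (p : Seminorm ℂ (FamilyCont X))) := by
  rw [SeminormFamily.withSeminorms_iff_nhds_eq_iInf]
  refine le_antisymm (le_iInf fun p => ?_) ?_
  · have := p.2.2.tendsto 0
    rw [map_zero] at this
    exact this.le_comap
  · have h : nhds (0 : FamilyCont X) = ⨅ K : X.family,
        Filter.comap (restrict K.1) (nhds (restrict K.1 0)) := by
      have := congrArg (fun t => @nhds (FamilyCont X) t 0) (topology_eq (X := X))
      refine this.trans ?_
      rw [nhds_iInf]
      simp only [nhds_induced]
    rw [h]
    refine le_iInf fun K => ?_
    have := compactSpace_of_mem K.2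
    let p : Seminorm ℂ (FamilyCont X) :=
      (normSeminorm ℂ C(K.1, ℂ)).comp (restrict K.1).toAlgHom.toLinearMap
    have hp (f : FamilyCont X) : p f = ‖restrict K.1 f‖ := rfl
    have hp' : IsCStarSeminorm p ∧ Continuous p := by
      refine ⟨⟨fun a b => ?_, fun a => ?_⟩, ?_⟩
      · simp only [hp, map_mul]
        exact norm_mul_le _ _
      · simp only [hp, map_mul, map_star]
        exact CStarRing.norm_star_mul_self
      · exact continuous_norm.comp (continuous_restrict K.2)
    refine (iInf_le _ ⟨p, hp'⟩).trans (le_of_eq ?_)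
    rw [map_zero (restrict K.1), ← comap_norm_nhds_zero (E := C(K.1, ℂ)), Filter.comap_comap]
    rfl

instance : IsProCStarAlgebra (FamilyCont X) where
  isUniformAddGroup := inferInstance
  isTopologicalRing := inferInstance
  continuousStar := inferInstance
  continuousSMul := inferInstance
  t2Space := inferInstance
  completeSpace := inferInstance
  withSeminorms := withSeminorms

/-- Precomposition with a morphism of Tychonoff spaces with families. -/
def precomp {X Y : FDTych.{u}} (f : X ⟶ Y) : FamilyCont Y →⋆ₐ[ℂ] FamilyCont X :=
  ContinuousMap.compStarAlgHom' ℂ ℂ (FDTych.Hom.toContinuousMap f)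

theorem continuous_precomp {X Y : FDTych.{u}} (f : X ⟶ Y) : Continuous (precomp f) := by
  refine continuous_induced_rng.mpr ?_
  exact (UniformOnFun.precomp_uniformContinuous
    (fun K hK => FDTych.Hom.image_mem f K hK)).continuous.comp continuous_induced_dom

end

end FamilyCont

/-- The contravariant functor that sends `(X, 𝓕)` to the ⋆-algebra of continuous complex-valued
functions on `X` with the topology of uniform convergence on members of `𝓕`, and a morphism `f` to
`g ↦ g ∘ f`. -/
noncomputable def familyContFunctor :
    CategoryTheory.Functor (FDTych.{u})ᵒᵖ CommProCStarAlg.{u} where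
  obj X := { carrier := FamilyCont X.unop }
  map f := ⟨FamilyCont.precomp f.unop, FamilyCont.continuous_precomp f.unop⟩
  map_id _ := rfl
  map_comp _ _ := rfl

/-! This is Gelfand duality with one compact space replaced by a directed family of compact sets;
the functor is shown to be fully faithful and essentially surjective.

Fullness: if `φ` is a continuous ⋆-homomorphism, then by scaling, the values of `φ g` on a member
`K` depend only on `g` restricted to one member `L` (`exists_vanishing`). For `x ∈ K`, the character
`g ↦ φ g x` is therefore supported on the compact set `L`, hence is evaluation at a point of `L`
(`ContinuousMap.exists_eq_eval_of_isCompact`). These points define the required map. Faithfulness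
holds because functions separate points.

Essential surjectivity: the continuous characters of `A` carry the pointwise topology and the
compact sets dominated by a continuous C⋆-seminorm. Gelfand theory in the completion for `p`
recovers `p` from the characters it dominates (`IsCStarSeminorm.exists_character`), so the Gelfand
transform is a topological embedding. Stone–Weierstrass on each dominated set and completeness of
`A` make it surjective (`exists_eq_apply`). This last argument needs continuity only on dominated
sets, so it also shows that the family is functionally distinguished. -/

open Topology Filter

/-! ### Characters of seminormed C⋆-algebras -/

section Completion

open UniformSpace

variable {B : Type*} [SeminormedCommRing B] [StarRing B]

theorem uniformContinuous_star_of_norm_star (hs : ∀ b : B, ‖star b‖ = ‖b‖) :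
    UniformContinuous (star : B → B) :=
  AddMonoidHomClass.uniformContinuous_of_bound (starAddEquiv : B ≃+ B) 1
    fun b => by simpa using (hs b).le

/-- The completion of a commutative seminormed ring with an isometric involution is a ⋆-ring. -/
noncomputable abbrev completionStarRing (hs : ∀ b : B, ‖star b‖ = ‖b‖) :
    StarRing (Completion B) :=
  have hc : Continuous (Completion.map (star : B → B)) := Completion.continuous_map
  have hcoe (b : B) : Completion.map star (b : Completion B) = (star b : B) :=
    Completion.map_coe (uniformContinuous_star_of_norm_star hs) b
  { star := Completion.map star
    star_involutive := fun x => by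
      induction x using Completion.induction_on with
      | hp => exact isClosed_eq (hc.comp hc) continuous_id
      | ih b => simp only [hcoe, star_star]
    star_mul := fun x y => by
      induction x, y using Completion.induction_on₂ with
      | hp =>
        exact isClosed_eq (hc.comp (continuous_fst.mul continuous_snd))
          ((hc.comp continuous_snd).mul (hc.comp continuous_fst))
      | ih a b => rw [hcoe, hcoe, ← Completion.coe_mul, ← Completion.coe_mul, hcoe, star_mul]
    star_add := fun x y => by
      induction x, y using Completion.induction_on₂ with
      | hp =>
        exact isClosed_eq (hc.comp (continuous_fst.add continuous_snd))
          ((hc.comp continuous_fst).add (hc.comp continuous_snd))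
      | ih a b => rw [hcoe, hcoe, ← Completion.coe_add, ← Completion.coe_add, hcoe, star_add] }

/-- The completion of a commutative algebra with a C⋆-seminorm is a commutative C⋆-algebra. -/
noncomputable abbrev completionCommCStarAlgebra [NormedAlgebra ℂ B] [StarModule ℂ B]
    (h : ∀ b : B, ‖star b * b‖ = ‖b‖ * ‖b‖) (hs : ∀ b : B, ‖star b‖ = ‖b‖) :
    CommCStarAlgebra (Completion B) :=
  letI := completionStarRing hs
  have hstar (b : B) : star (b : Completion B) = (star b : B) :=
    Completion.map_coe (uniformContinuous_star_of_norm_star hs) b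
  have hc : Continuous (star : Completion B → Completion B) := Completion.continuous_map
  { norm_mul_self_le := fun x => by
      induction x using Completion.induction_on with
      | hp =>
        exact isClosed_le (continuous_norm.mul continuous_norm)
          (continuous_norm.comp (hc.mul continuous_id))
      | ih b => rw [hstar, ← Completion.coe_mul, Completion.norm_coe, Completion.norm_coe, h]
    star_smul := fun r x => by
      induction x using Completion.induction_on with
      | hp =>
        exact isClosed_eq (hc.comp (continuous_const_smul r)) (hc.const_smul (star r))
      | ih b =>
        rw [hstar, ← Completion.coe_smul, ← Completion.coe_smul, hstar, star_smul] }

end Completion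

/-- The Gelfand transform is isometric and the character space is compact, so the supremum norm is
attained. -/
theorem CommCStarAlgebra.exists_character_norm_eq {B : Type*} [CommCStarAlgebra B] {a : B}
    (ha : a ≠ 0) :
    ∃ χ : B →⋆ₐ[ℂ] ℂ, (∀ b, ‖χ b‖ ≤ ‖b‖) ∧ ‖χ a‖ = ‖a‖ := by
  have : Nontrivial B := ⟨a, 0, ha⟩
  have hn (b : B) : ‖WeakDual.gelfandTransform ℂ B b‖ = ‖b‖ :=
    (gelfandTransform_isometry B).norm_map_of_map_zero (map_zero _) b
  obtain ⟨φ, -, hφ⟩ := isCompact_univ.exists_isMaxOn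
    (Set.univ_nonempty (α := WeakDual.characterSpace ℂ B))
    (continuous_norm.comp (WeakDual.gelfandTransform ℂ B a).continuous).continuousOn
  have hle (b : B) : ‖φ b‖ ≤ ‖b‖ :=
    ((WeakDual.gelfandTransform ℂ B b).norm_coe_le_norm φ).trans (hn b).le
  refine ⟨{ WeakDual.CharacterSpace.toAlgHom φ with map_star' := fun b => map_star φ b },
    hle, le_antisymm (hle a) ?_⟩
  rw [← hn, ContinuousMap.norm_le _ (norm_nonneg _)]
  exact fun ψ => hφ (Set.mem_univ ψ)

section Seminorm

variable {A : Type*} [CommRing A] [StarRing A] [Algebra ℂ A] {p q : Seminorm ℂ A}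

namespace IsCStarSeminorm

/-- Cancel `p b` in `p b * p b = p (star b * b) ≤ p (star b) * p b`, then apply the result to `star
b`. -/
theorem map_star (hp : IsCStarSeminorm p) (a : A) : p (star a) = p a := by
  have key (b : A) : p b ≤ p (star b) := by
    rcases (apply_nonneg p b).eq_or_lt with h | h
    · rw [← h]; exact apply_nonneg p _
    · have := (hp.map_star_mul_self b).symm.le.trans (hp.map_mul_le _ _)
      exact le_of_mul_le_mul_right this h
  exact le_antisymm (by simpa using key (star a)) (key a)

/-- Makes the continuous C⋆-seminorms directed, so that one of them can replace finitely many. -/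
theorem sup (hp : IsCStarSeminorm p) (hq : IsCStarSeminorm q) : IsCStarSeminorm (p ⊔ q) where
  map_mul_le a b := by
    simp only [Seminorm.sup_apply]
    refine max_le ((hp.map_mul_le a b).trans ?_) ((hq.map_mul_le a b).trans ?_)
    · exact mul_le_mul (le_max_left _ _) (le_max_left _ _) (apply_nonneg _ _)
        ((apply_nonneg p a).trans (le_max_left _ _))
    · exact mul_le_mul (le_max_right _ _) (le_max_right _ _) (apply_nonneg _ _)
        ((apply_nonneg p a).trans (le_max_left _ _))
  map_star_mul_self a := by
    simp only [Seminorm.sup_apply, hp.map_star_mul_self, hq.map_star_mul_self]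
    rcases le_total (p a) (q a) with h | h
    · rw [max_eq_right h, max_eq_right (mul_self_le_mul_self (apply_nonneg _ _) h)]
    · rw [max_eq_left h, max_eq_left (mul_self_le_mul_self (apply_nonneg _ _) h)]

theorem zero : IsCStarSeminorm (0 : Seminorm ℂ A) where
  map_mul_le a b := by simp
  map_star_mul_self a := by simp

variable [StarModule ℂ A]

/-- With `p` as seminorm, the separated completion of `A` is a commutative C⋆-algebra; a
norm-attaining character of it pulls back to `A`. The completion also kills the kernel of `p`, so no
quotient is formed. -/
theorem exists_character (hp : IsCStarSeminorm p) {a : A} (ha : p a ≠ 0) :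
    ∃ χ : A →⋆ₐ[ℂ] ℂ, (∀ b, ‖χ b‖ ≤ p b) ∧ ‖χ a‖ = p a := by
  let _ : SeminormedCommRing A :=
    { p.toAddGroupSeminorm.toSeminormedAddCommGroup, ‹CommRing A› with
      norm_mul_le := hp.map_mul_le }
  have hnorm (b : A) : ‖b‖ = p b := rfl
  let _ : NormedAlgebra ℂ A :=
    { ‹Algebra ℂ A› with
      norm_smul_le := fun r b => (map_smul_eq_mul p r b).le }
  let _ := completionCommCStarAlgebra (B := A) hp.map_star_mul_self hp.map_star
  have hstar (b : A) : star (b : UniformSpace.Completion A) = (star b : A) :=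
    UniformSpace.Completion.map_coe (uniformContinuous_star_of_norm_star hp.map_star) b
  obtain ⟨χ, hχ, hχa⟩ := CommCStarAlgebra.exists_character_norm_eq
    (a := (a : UniformSpace.Completion A)) fun h => ha <| by
      rw [← hnorm, ← UniformSpace.Completion.norm_coe, h, norm_zero]
  refine ⟨{ (χ : UniformSpace.Completion A →ₐ[ℂ] ℂ).comp
      { UniformSpace.Completion.coeRingHom with
        commutes' := fun r => rfl } with
      map_star' := fun b => ?_ }, fun b => ?_, ?_⟩
  · change χ ((star b : A) : UniformSpace.Completion A) = star (χ b)
    rw [← StarHomClass.map_star, hstar]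
  · exact (hχ b).trans (UniformSpace.Completion.norm_coe b).le
  · exact hχa.trans (UniformSpace.Completion.norm_coe a)

end IsCStarSeminorm

end Seminorm

/-! ### Continuous functions on Tychonoff spaces -/

theorem exists_continuousMap_eq_one_of_notMem {Y : Type*} [TopologicalSpace Y]
    [CompletelyRegularSpace Y] {L : Set Y} (hL : IsClosed L) {y : Y} (hy : y ∉ L) :
    ∃ g : C(Y, ℂ), g y = 1 ∧ ∀ z ∈ L, g z = 0 := by
  obtain ⟨f, hf, hfy, hfL⟩ := CompletelyRegularSpace.completely_regular y L hL hy
  refine ⟨⟨fun z => 1 - ((f z : ℝ) : ℂ), by fun_prop⟩, ?_, fun z hz => ?_⟩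
  · simp [hfy]
  · simp [hfL hz]

theorem eq_of_forall_continuousMap_eq {Y : Type*} [TopologicalSpace Y] [T35Space Y] {y z : Y}
    (h : ∀ g : C(Y, ℂ), g y = g z) : y = z := by
  by_contra hyz
  obtain ⟨g, h1, h0⟩ := exists_continuousMap_eq_one_of_notMem (isClosed_singleton (x := z)) hyz
  exact one_ne_zero (h1.symm.trans ((h g).trans (h0 z rfl)))

/-- A completely regular space has the initial topology of its continuous functions: the
nonvanishing set of a suitable `g` is a neighbourhood inside any given one. -/
theorem continuous_of_forall_continuousMap_comp {X Y : Type*} [TopologicalSpace X]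
    [TopologicalSpace Y] [CompletelyRegularSpace Y] {F : X → Y}
    (h : ∀ g : C(Y, ℂ), Continuous fun x => g (F x)) : Continuous F := by
  rw [continuous_iff_continuousAt]
  intro x s hs
  obtain ⟨U, hUs, hU, hxU⟩ := mem_nhds_iff.mp hs
  obtain ⟨g, h1, h0⟩ := exists_continuousMap_eq_one_of_notMem hU.isClosed_compl
    (Set.notMem_compl_iff.mpr hxU)
  have : ∀ᶠ x' in 𝓝 x, g (F x') ≠ 0 :=
    (h g).continuousAt.eventually_ne (by rw [h1]; exact one_ne_zero)
  rw [Filter.mem_map]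
  filter_upwards [this] with x' hx'
  by_contra hn
  exact hx' (h0 _ fun hU => hn (hUs hU))

/-- A character of `C(Y, ℂ)` which vanishes on the functions that vanish on a compact set `L` is
the evaluation at a point of `L`. -/
theorem ContinuousMap.exists_eq_eval_of_isCompact {Y : Type*} [TopologicalSpace Y] [T2Space Y]
    {L : Set Y} (hL : IsCompact L) (χ : C(Y, ℂ) →⋆ₐ[ℂ] ℂ)
    (hχ : ∀ g : C(Y, ℂ), (∀ y ∈ L, g y = 0) → χ g = 0) :
    ∃ y ∈ L, ∀ g : C(Y, ℂ), χ g = g y := by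
  suffices H : (L ∩ ⋂ g : C(Y, ℂ), {y | g y = χ g}).Nonempty by
    obtain ⟨y, hy, hg⟩ := H
    exact ⟨y, hy, fun g => (Set.mem_iInter.mp hg g).symm⟩
  refine hL.inter_iInter_nonempty _
    (fun g => isClosed_eq g.continuous continuous_const) fun t => ?_
  by_contra hne
  -- If finitely many of these closed sets have no common point in `L`, the sum of squares `r` is
  -- positive on `L`, while `χ` kills it as a complex function.
  let r : C(Y, ℝ) := ∑ g ∈ t, ⟨fun y => ‖g y - χ g‖ ^ 2, by fun_prop⟩
  have hr (y : Y) : r y = ∑ g ∈ t, ‖g y - χ g‖ ^ 2 := by simp [r]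
  let h : C(Y, ℂ) := ∑ g ∈ t, star (g - algebraMap ℂ _ (χ g)) * (g - algebraMap ℂ _ (χ g))
  have hh (y : Y) : h y = (r y : ℂ) := by
    simp only [hr, h, ContinuousMap.sum_apply, Complex.ofReal_sum, Complex.ofReal_pow]
    exact Finset.sum_congr rfl fun g _ => Complex.conj_mul' _
  have hχh : χ h = 0 := by
    simp [h, map_sum, AlgHomClass.commutes]
  have hpos : ∀ y ∈ L, 0 < r y := by
    intro y hy
    rw [hr]
    refine (Finset.sum_nonneg fun g _ => sq_nonneg _).lt_of_ne fun h0 => hne ⟨y, hy, ?_⟩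
    rw [eq_comm, Finset.sum_eq_zero_iff_of_nonneg fun g _ => sq_nonneg _] at h0
    simp only [Set.mem_iInter, Set.mem_ofPred_eq]
    intro g hg
    simpa [sub_eq_zero] using h0 g hg
  obtain ⟨δ, hδ, hδr⟩ := hL.exists_forall_le' r.continuous.continuousOn hpos
  have hm (y : Y) : ((max (r y) δ : ℝ) : ℂ) ≠ 0 :=
    Complex.ofReal_ne_zero.mpr (hδ.trans_le (le_max_right _ _)).ne'
  -- Truncating below at `δ` makes the function invertible on all of `Y` without changing it on `L`,
  -- so `χ` would kill a unit.
  let k : C(Y, ℂ) := ⟨fun y => ((max (r y) δ : ℝ) : ℂ), by fun_prop⟩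
  let k' : C(Y, ℂ) := ⟨fun y => ((max (r y) δ : ℝ) : ℂ)⁻¹,
    Continuous.inv₀ (by fun_prop) hm⟩
  have hkk : k * k' = 1 := by
    ext y
    exact mul_inv_cancel₀ (hm y)
  have hk : χ k = 0 := by
    have := hχ (k - h) fun y hy => by
      rw [ContinuousMap.sub_apply, hh, sub_eq_zero]
      exact congrArg Complex.ofReal (max_eq_left (hδr y hy))
    rwa [map_sub, hχh, sub_zero] at this
  have := congrArg χ hkk
  rw [map_mul, hk, zero_mul, map_one] at this
  exact zero_ne_one this

/-! ### The functor is fully faithful -/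

namespace FamilyCont

variable {X Y : FDTych.{u}}

/-- Closure under finite unions makes the family directed, so a single `K` suffices. -/
theorem nhds_hasBasis (f : FamilyCont X) :
    (𝓝 f).HasBasis (fun Kε : Set X.carrier × ℝ => Kε.1 ∈ X.family ∧ 0 < Kε.2)
      fun Kε => {g | ∀ x ∈ Kε.1, ‖(show C(X.carrier, ℂ) from g) x -
        (show C(X.carrier, ℂ) from f) x‖ < Kε.2} := by
  have hX := X.isFunctionallyDistinguished
  have hne : X.family.Nonempty :=
    ⟨⋃₀ ∅, hX.sUnion_mem ∅ (Set.empty_subset _) Set.finite_empty⟩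
  have hdir : DirectedOn (· ⊆ ·) X.family := fun K hK L hL =>
    ⟨⋃₀ {K, L}, hX.sUnion_mem _ (Set.pair_subset hK hL) (Set.toFinite _),
      Set.subset_sUnion_of_mem (by simp), Set.subset_sUnion_of_mem (by simp)⟩
  have h := (UniformOnFun.hasBasis_nhds_of_basis X.carrier ℂ X.family (toUniformOnFun X f)
    hne hdir Metric.uniformity_basis_dist).comap (toUniformOnFun X)
  rw [← nhds_induced] at h
  refine h.congr (fun _ => Iff.rfl) fun Kε _ => ?_
  ext g
  simp only [Set.mem_preimage, UniformOnFun.gen, Set.mem_ofPred_eq, dist_eq_norm]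
  rfl

/-- A continuous ⋆-homomorphism maps functions that vanish on a suitable member of the family of
`Y` to functions that vanish on a given member of the family of `X`. -/
theorem exists_vanishing (φ : FamilyCont Y →⋆ₐ[ℂ] FamilyCont X) (hφ : Continuous φ)
    {K : Set X.carrier} (hK : K ∈ X.family) :
    ∃ L ∈ Y.family, ∀ g : C(Y.carrier, ℂ), (∀ y ∈ L, g y = 0) →
      ∀ x ∈ K, (show C(X.carrier, ℂ) from φ g) x = 0 := by
  obtain ⟨⟨L, δ⟩, ⟨hL, hδ⟩, h⟩ := ((nhds_hasBasis 0).tendsto_iff (nhds_hasBasis (φ 0))).mp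
    (hφ.tendsto 0) (K, 1) ⟨hK, one_pos⟩
  refine ⟨L, hL, fun g hg x hx => ?_⟩
  set c := (show C(X.carrier, ℂ) from φ g) x with hc
  by_contra hne
  -- Every multiple of `g` vanishes on `L` and so stays in the neighbourhood; the multiple by `c⁻¹`
  -- has image of value `1` at `x`, contradicting the bound `< 1`.
  have h1 := h ((c⁻¹ • g : C(Y.carrier, ℂ))) (fun y hy => by
    change ‖c⁻¹ • g y - 0‖ < δ
    rw [hg y hy]
    simpa using hδ) x hx
  have h2 : (show C(X.carrier, ℂ) from φ (c⁻¹ • g : C(Y.carrier, ℂ))) x = c⁻¹ * c := by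
    have := congrArg (fun f : C(X.carrier, ℂ) => f x) (map_smul φ c⁻¹ (show FamilyCont Y from g))
    exact this
  have h3 : (show C(X.carrier, ℂ) from φ 0) x = 0 :=
    congrArg (fun f : C(X.carrier, ℂ) => f x) (map_zero φ)
  simp only at h1
  rw [h2, h3, inv_mul_cancel₀ hne] at h1
  simp at h1

theorem exists_precomp_eq (φ : FamilyCont Y →⋆ₐ[ℂ] FamilyCont X) (hφ : Continuous φ) :
    ∃ f : X ⟶ Y, precomp f = φ := by
  have key {K : Set X.carrier} (hK : K ∈ X.family) :
      ∃ L ∈ Y.family, ∀ x ∈ K, ∃ y ∈ L, ∀ g : C(Y.carrier, ℂ),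
        (show C(X.carrier, ℂ) from φ g) x = g y := by
    obtain ⟨L, hL, h⟩ := exists_vanishing φ hφ hK
    refine ⟨L, hL, fun x hx => ?_⟩
    exact ContinuousMap.exists_eq_eval_of_isCompact (Y.isFunctionallyDistinguished.isCompact L hL)
      ((ContinuousMap.evalStarAlgHom ℂ ℂ x).comp φ) fun g hg => h g hg x hx
  have key' (x : X.carrier) : ∃ y, ∀ g : C(Y.carrier, ℂ),
      (show C(X.carrier, ℂ) from φ g) x = g y := by
    obtain ⟨L, -, h⟩ := key (X.isFunctionallyDistinguished.singleton_mem x)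
    obtain ⟨y, -, hy⟩ := h x rfl
    exact ⟨y, hy⟩
  choose F hF using key'
  have hFc : Continuous F := continuous_of_forall_continuousMap_comp fun g => by
    simp only [← hF]
    exact (show C(X.carrier, ℂ) from φ g).continuous
  refine ⟨⟨⟨F, hFc⟩, fun K hK => ?_⟩, ?_⟩
  · obtain ⟨L, hL, h⟩ := key hK
    refine Y.isFunctionallyDistinguished.mem_of_subset L hL _ ?_
      ((X.isFunctionallyDistinguished.isCompact K hK).image hFc)
    rintro _ ⟨x, hx, rfl⟩
    -- The point of `L` found for `K` is `F x`, since continuous functions separate points of `Y`.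
    obtain ⟨y, hy, hyg⟩ := h x hx
    rwa [ContinuousMap.coe_mk,
      eq_of_forall_continuousMap_eq fun g => (hF x g).symm.trans (hyg g)]
  · ext g : 1
    exact ContinuousMap.ext fun x => (hF x g).symm

theorem precomp_injective : Function.Injective (precomp : (X ⟶ Y) → _) := by
  intro f g h
  refine FDTych.Hom.ext (ContinuousMap.ext fun x => eq_of_forall_continuousMap_eq fun k => ?_)
  exact congrArg (fun φ : FamilyCont Y →⋆ₐ[ℂ] FamilyCont X =>
    (show C(X.carrier, ℂ) from φ k) x) h

end FamilyCont

instance : (familyContFunctor.{u}).Faithful where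
  map_injective h := Quiver.Hom.unop_inj <| FamilyCont.precomp_injective <|
    congrArg CommProCStarAlg.Hom.toStarAlgHom h

instance : (familyContFunctor.{u}).Full where
  map_surjective φ := by
    obtain ⟨f, hf⟩ := FamilyCont.exists_precomp_eq _ (CommProCStarAlg.Hom.continuous φ)
    exact ⟨f.op, CommProCStarAlg.Hom.ext hf⟩

/-! ### The character space of a commutative pro-C⋆-algebra -/

namespace CommProCStarAlg

section

variable (A : CommProCStarAlg.{u})

instance : IsUniformAddGroup A.carrier := IsProCStarAlgebra.isUniformAddGroup
instance : IsTopologicalRing A.carrier := IsProCStarAlgebra.isTopologicalRing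
instance : T2Space A.carrier := IsProCStarAlgebra.t2Space
instance : CompleteSpace A.carrier := IsProCStarAlgebra.completeSpace

/-- The continuous C⋆-seminorms. -/
abbrev CSeminorm : Type u :=
  {p : Seminorm ℂ A.carrier // IsCStarSeminorm p ∧ Continuous p}

instance : Nonempty A.CSeminorm :=
  ⟨⟨0, IsCStarSeminorm.zero, continuous_const⟩⟩

theorem nhds_zero_hasBasis : (𝓝 (0 : A.carrier)).HasBasis
    (fun pr : A.CSeminorm × ℝ => 0 < pr.2) fun pr => {a | pr.1.1 a < pr.2} := by
  have h : WithSeminorms (fun p : A.CSeminorm => p.1) := IsProCStarAlgebra.withSeminorms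
  refine ⟨fun U => ?_⟩
  rw [h.hasBasis_zero_ball.mem_iff]
  constructor
  · rintro ⟨⟨s, r⟩, hr, hU⟩
    have hs : ∃ q : A.CSeminorm, s.sup (fun p : A.CSeminorm => p.1) ≤ q.1 := by
      clear hU hr
      induction s using Finset.cons_induction with
      | empty => exact ⟨Classical.arbitrary _, by simp⟩
      | cons p s _ ih =>
        obtain ⟨q, hq⟩ := ih
        refine ⟨⟨p.1 ⊔ q.1, p.2.1.sup q.2.1, ?_⟩, ?_⟩
        · exact p.2.2.sup q.2.2
        · rw [Finset.sup_cons]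
          exact sup_le_sup le_rfl hq
    obtain ⟨q, hq⟩ := hs
    refine ⟨⟨q, r⟩, hr, fun a ha => hU ?_⟩
    rw [Seminorm.mem_ball_zero]
    exact (hq a).trans_lt ha
  · rintro ⟨⟨p, r⟩, hr, hU⟩
    refine ⟨⟨{p}, r⟩, hr, fun a ha => hU ?_⟩
    simpa [Seminorm.mem_ball_zero] using ha

variable {A} in
theorem continuous_of_bound (χ : A.carrier →⋆ₐ[ℂ] ℂ) (p : A.CSeminorm)
    (h : ∀ a, ‖χ a‖ ≤ p.1 a) : Continuous χ := by
  refine continuous_of_continuousAt_zero χ ?_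
  rw [ContinuousAt, map_zero]
  refine squeeze_zero_norm h ?_
  simpa using p.2.2.tendsto 0

variable {A} in
/-- The modulus of a continuous character, as a continuous C⋆-seminorm. -/
noncomputable def normSeminormOfCharacter (χ : A.carrier →⋆ₐ[ℂ] ℂ) (hχ : Continuous χ) :
    A.CSeminorm :=
  ⟨(normSeminorm ℂ ℂ).comp χ.toAlgHom.toLinearMap,
    ⟨fun a b => by
      change ‖χ (a * b)‖ ≤ ‖χ a‖ * ‖χ b‖
      rw [map_mul, norm_mul],
    fun a => by
      change ‖χ (star a * a)‖ = ‖χ a‖ * ‖χ a‖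
      rw [map_mul, map_star, norm_mul, norm_star]⟩,
    hχ.norm⟩

/-- The space of continuous characters, with the topology of pointwise convergence. -/
def Character : Type u := {χ : A.carrier →⋆ₐ[ℂ] ℂ // Continuous χ}

variable {A}

noncomputable instance : FunLike A.Character A.carrier ℂ where
  coe χ := χ.1
  coe_injective _ _ h := Subtype.ext (DFunLike.coe_injective h)

noncomputable instance : TopologicalSpace A.Character :=
  TopologicalSpace.induced (fun χ => (χ : A.carrier → ℂ)) inferInstance

namespace Character

theorem isEmbedding_coe : IsEmbedding (fun χ : A.Character => (χ : A.carrier → ℂ)) :=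
  ⟨⟨rfl⟩, DFunLike.coe_injective⟩

instance : T35Space A.Character := isEmbedding_coe.t35Space

theorem continuous_eval (a : A.carrier) : Continuous fun χ : A.Character => χ a :=
  (continuous_apply a).comp isEmbedding_coe.continuous

/-- The characters dominated by a seminorm. -/
def dominated (p : A.CSeminorm) : Set A.Character := {χ | ∀ a, ‖χ a‖ ≤ p.1 a}

theorem dominated_mono {p q : A.CSeminorm} (h : p.1 ≤ q.1) : dominated p ⊆ dominated q :=
  fun _ hχ a => (hχ a).trans (h a)

/-- Banach–Alaoglu: the algebraic identities cut out a closed subset of a product of closed discs.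
The bound by `p` survives pointwise limits and makes them continuous. -/
theorem isCompact_dominated (p : A.CSeminorm) : IsCompact (dominated p) := by
  rw [isEmbedding_coe.isInducing.isCompact_iff]
  have hK : IsCompact (Set.univ.pi fun a : A.carrier => Metric.closedBall (0 : ℂ) (p.1 a)) :=
    isCompact_univ_pi fun a => isCompact_closedBall _ _
  have hc (a : A.carrier) : Continuous fun φ : A.carrier → ℂ => φ a := continuous_apply a
  let C : Set (A.carrier → ℂ) := {φ | φ 1 = 1} ∩ ((⋂ a, ⋂ b, {φ | φ (a * b) = φ a * φ b}) ∩
    ((⋂ a, ⋂ b, {φ | φ (a + b) = φ a + φ b}) ∩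
    ((⋂ r : ℂ, ⋂ a, {φ | φ (r • a) = r • φ a}) ∩ ⋂ a, {φ | φ (star a) = star (φ a)})))
  have hC : IsClosed C := by
    refine (isClosed_eq (hc _) continuous_const).inter ?_
    refine IsClosed.inter ?_ (IsClosed.inter ?_ (IsClosed.inter ?_ ?_))
    · exact isClosed_iInter fun a => isClosed_iInter fun b =>
        isClosed_eq (hc _) ((hc _).mul (hc _))
    · exact isClosed_iInter fun a => isClosed_iInter fun b =>
        isClosed_eq (hc _) ((hc _).add (hc _))
    · exact isClosed_iInter fun r => isClosed_iInter fun b =>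
        isClosed_eq (hc _) ((hc _).const_smul r)
    · exact isClosed_iInter fun a => isClosed_eq (hc _) (hc _).star
  convert hK.inter_right hC
  ext φ
  simp only [C, Set.mem_image, Set.mem_inter_iff, Set.mem_iInter, Set.mem_ofPred_eq,
    Set.mem_univ_pi, mem_closedBall_zero_iff]
  constructor
  · rintro ⟨χ, hχ, rfl⟩
    exact ⟨hχ, map_one χ.1, map_mul χ.1, map_add χ.1, map_smul χ.1, map_star χ.1⟩
  · rintro ⟨hφ, h1, hm, ha, hs, hst⟩
    have h0 : φ 0 = 0 := by simpa using hs 0 0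
    let χ : A.carrier →⋆ₐ[ℂ] ℂ :=
      { toFun := φ
        map_one' := h1
        map_mul' := hm
        map_zero' := h0
        map_add' := ha
        commutes' := fun r => by rw [Algebra.algebraMap_eq_smul_one, hs, h1, Algebra.algebraMap_eq_smul_one]
        map_star' := hst }
    refine ⟨⟨χ, continuous_of_bound χ p hφ⟩, hφ, rfl⟩

variable (A) in
/-- The compact sets of characters that are dominated by a continuous C⋆-seminorm. -/
def family : Set (Set A.Character) := {K | IsCompact K ∧ ∃ p, K ⊆ dominated p}

theorem dominated_mem_family (p : A.CSeminorm) : dominated p ∈ family A :=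
  ⟨isCompact_dominated p, p, subset_rfl⟩

theorem singleton_mem_family (χ : A.Character) : {χ} ∈ family A :=
  -- A continuous character is dominated by its own modulus.
  ⟨isCompact_singleton, normSeminormOfCharacter χ.1 χ.2, by
    rintro _ rfl
    exact fun a => le_rfl⟩

theorem sUnion_mem_family {S : Set (Set A.Character)} (hS : S ⊆ family A) (hfin : S.Finite) :
    ⋃₀ S ∈ family A := by
  induction S, hfin using Set.Finite.induction_on with
  | empty => exact ⟨by simp, Classical.arbitrary _, by simp⟩
  | @insert K S _ _ ih =>
    obtain ⟨hSc, q, hq⟩ := ih ((Set.subset_insert _ _).trans hS)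
    obtain ⟨hKc, p, hp⟩ := hS (Set.mem_insert K S)
    rw [Set.sUnion_insert]
    refine ⟨hKc.union hSc, ⟨p.1 ⊔ q.1, p.2.1.sup q.2.1, p.2.2.sup q.2.2⟩, Set.union_subset ?_ ?_⟩
    · exact hp.trans (dominated_mono le_sup_left)
    · exact hq.trans (dominated_mono le_sup_right)

/-- Elements of a pro-C⋆-algebra approximate a function on the characters which is continuous
on the set of characters dominated by a seminorm. -/
theorem exists_norm_sub_lt {f : A.Character → ℂ} {p : A.CSeminorm}
    (hf : ContinuousOn f (dominated p)) {ε : ℝ} (hε : 0 < ε) :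
    ∃ a : A.carrier, ∀ χ ∈ dominated p, ‖χ a - f χ‖ < ε := by
  have : CompactSpace (dominated p) := isCompact_iff_compactSpace.mp (isCompact_dominated p)
  let γ : A.carrier →⋆ₐ[ℂ] C(dominated p, ℂ) :=
    { toFun := fun a => ⟨fun χ => χ.1 a, (continuous_eval a).comp continuous_subtype_val⟩
      map_one' := ContinuousMap.ext fun χ => map_one χ.1.1
      map_mul' := fun a b => ContinuousMap.ext fun χ => map_mul χ.1.1 a b
      map_zero' := ContinuousMap.ext fun χ => map_zero χ.1.1
      map_add' := fun a b => ContinuousMap.ext fun χ => map_add χ.1.1 a b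
      commutes' := fun r => ContinuousMap.ext fun χ => AlgHomClass.commutes χ.1.1 r
      map_star' := fun a => ContinuousMap.ext fun χ => map_star χ.1.1 a }
  have hsep : γ.range.SeparatesPoints := by
    intro χ ψ hne
    have : ∃ a, χ.1 a ≠ ψ.1 a := by
      by_contra! h
      exact hne (Subtype.ext (DFunLike.ext _ _ h))
    obtain ⟨a, ha⟩ := this
    exact ⟨_, ⟨γ a, ⟨a, rfl⟩, rfl⟩, ha⟩
  let F : C(dominated p, ℂ) := ⟨fun χ => f χ.1, continuousOn_iff_continuous_domRestrict.mp hf⟩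
  -- Stone–Weierstrass on the compact set `dominated p`.
  have hF : F ∈ closure (γ.range : Set C(dominated p, ℂ)) := by
    rw [← StarSubalgebra.topologicalClosure_coe,
      ContinuousMap.starSubalgebra_topologicalClosure_eq_top_of_separatesPoints _ hsep]
    trivial
  obtain ⟨_, ⟨a, rfl⟩, ha⟩ := Metric.mem_closure_iff.mp hF ε hε
  refine ⟨a, fun χ hχ => ?_⟩
  rw [← dist_eq_norm, dist_comm]
  exact (ContinuousMap.dist_apply_le_dist (f := F) (g := γ a) ⟨χ, hχ⟩).trans_lt ha

/-- When `p a` is nonzero, some character in `dominated p` attains it. -/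
theorem seminorm_le_of_forall_norm_le {p : A.CSeminorm} {a : A.carrier} {r : ℝ} (hr : 0 ≤ r)
    (h : ∀ χ ∈ dominated p, ‖χ a‖ ≤ r) : p.1 a ≤ r := by
  by_cases ha : p.1 a = 0
  · exact ha.le.trans hr
  · obtain ⟨χ, hχ, hχa⟩ := p.2.1.exists_character ha
    exact hχa.ge.trans (h ⟨χ, continuous_of_bound χ p hχ⟩ hχ)

/-- A function on the characters that is continuous on the dominated sets is given by an element
of the algebra. -/
theorem exists_eq_apply {f : A.Character → ℂ} (hf : ∀ p, ContinuousOn f (dominated p)) :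
    ∃ a : A.carrier, ∀ χ : A.Character, χ a = f χ := by
  -- The filter of ever better approximations to `f`, uniform on dominated sets; its limit in `A` is
  -- the required element.
  let l : Filter A.carrier := ⨅ i : A.CSeminorm × {ε : ℝ // 0 < ε},
    𝓟 {a | ∀ χ ∈ dominated i.1, ‖χ a - f χ‖ < i.2}
  have hmem (p : A.CSeminorm) {ε : ℝ} (hε : 0 < ε) :
      {a | ∀ χ ∈ dominated p, ‖χ a - f χ‖ < ε} ∈ l :=
    mem_iInf_of_mem (p, ⟨ε, hε⟩) (mem_principal_self _)
  have hne : l.NeBot := by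
    have : Nonempty {ε : ℝ // 0 < ε} := ⟨⟨1, one_pos⟩⟩
    refine iInf_neBot_of_directed' ?_ fun i => ?_
    · rintro ⟨p, ε⟩ ⟨q, δ⟩
      refine ⟨(⟨p.1 ⊔ q.1, p.2.1.sup q.2.1, p.2.2.sup q.2.2⟩,
        ⟨min ε.1 δ.1, lt_min ε.2 δ.2⟩), ?_, ?_⟩
      · exact principal_mono.mpr fun a ha χ hχ =>
          (ha χ (dominated_mono le_sup_left hχ)).trans_le (min_le_left _ _)
      · exact principal_mono.mpr fun a ha χ hχ =>
          (ha χ (dominated_mono le_sup_right hχ)).trans_le (min_le_right _ _)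
    · exact principal_neBot_iff.mpr (exists_norm_sub_lt (hf i.1) i.2.2)
  have hl : Cauchy l := by
    refine ⟨hne, ?_⟩
    rw [uniformity_eq_comap_nhds_zero, ← tendsto_iff_comap, A.nhds_zero_hasBasis.tendsto_right_iff]
    rintro ⟨p, r⟩ hr
    -- Two errors of `r / 3` leave room for the strict inequality, as the supremum bound is only
    -- `≤`.
    have := hmem p (show 0 < r / 3 by simp only at hr; positivity)
    filter_upwards [prod_mem_prod this this] with ab hab
    refine (seminorm_le_of_forall_norm_le (r := r / 3 + r / 3) ?_ fun χ hχ => ?_).trans_lt ?_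
    · simp only at hr; positivity
    · have e : χ (ab.2 - ab.1) = (χ ab.2 - f χ) - (χ ab.1 - f χ) := by
        rw [sub_sub_sub_cancel_right]
        exact map_sub χ.1 _ _
      rw [e]
      exact (norm_sub_le _ _).trans (add_le_add (hab.2 χ hχ).le (hab.1 χ hχ).le)
    · simp only at hr ⊢; linarith
  obtain ⟨a, ha⟩ := CompleteSpace.complete hl
  refine ⟨a, fun χ => ?_⟩
  have h1 : Tendsto χ l (𝓝 (χ a)) := (χ.2.tendsto a).mono_left ha
  have h2 : Tendsto χ l (𝓝 (f χ)) := by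
    rw [tendsto_iff_norm_sub_tendsto_zero, (nhds_basis_zero_abs_lt ℝ).tendsto_right_iff]
    intro ε hε
    obtain ⟨-, p, hp⟩ := singleton_mem_family χ
    filter_upwards [hmem p hε] with b hb
    simpa using hb χ (hp rfl)
  exact tendsto_nhds_unique h1 h2

/-- Such an `f` is evaluation at an element of `A`, and evaluations are continuous by definition of
the topology. -/
theorem continuous_of_continuousOn_dominated {f : A.Character → ℂ}
    (hf : ∀ p, ContinuousOn f (dominated p)) : Continuous f := by
  obtain ⟨a, ha⟩ := exists_eq_apply hf
  exact (continuous_eval a).congr ha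

theorem isFunctionallyDistinguished_family : IsFunctionallyDistinguished (family A) where
  isCompact _ hK := hK.1
  singleton_mem := singleton_mem_family
  mem_of_subset _ hK _ hL hLc := ⟨hLc, hK.2.imp fun _ hp => hL.trans hp⟩
  sUnion_mem _ hS hfin := sUnion_mem_family hS hfin
  continuous_iff f := by
    refine ⟨fun h K _ => h.continuousOn, fun h => ?_⟩
    have : Continuous fun χ => (f χ : ℂ) := continuous_of_continuousOn_dominated fun p =>
      Complex.continuous_ofReal.comp_continuousOn (h _ (dominated_mem_family p))
    exact (Complex.continuous_re.comp this).congr fun χ => Complex.ofReal_re _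

end Character

/-! ### The Gelfand transform is an isomorphism -/

variable (A)

/-- The character space with the family of the dominated compact sets. -/
noncomputable def characterSpace : FDTych.{u} where
  carrier := A.Character
  family := Character.family A
  isFunctionallyDistinguished := Character.isFunctionallyDistinguished_family

/-- The Gelfand transform. -/
noncomputable def gelfand : A.carrier →⋆ₐ[ℂ] FamilyCont A.characterSpace where
  toFun a := (⟨fun χ => χ a, Character.continuous_eval a⟩ : C(A.Character, ℂ))
  map_one' := ContinuousMap.ext fun χ : A.Character => map_one χ.1
  map_mul' a b := ContinuousMap.ext fun χ : A.Character => map_mul χ.1 a b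
  map_zero' := ContinuousMap.ext fun χ : A.Character => map_zero χ.1
  map_add' a b := ContinuousMap.ext fun χ : A.Character => map_add χ.1 a b
  commutes' r := ContinuousMap.ext fun χ : A.Character => AlgHomClass.commutes χ.1 r
  map_star' a := ContinuousMap.ext fun χ : A.Character => map_star χ.1 a

theorem gelfand_surjective : Function.Surjective A.gelfand := fun f => by
  obtain ⟨a, ha⟩ := Character.exists_eq_apply (f := (show C(A.Character, ℂ) from f))
    fun p => (show C(A.Character, ℂ) from f).continuous.continuousOn
  exact ⟨a, ContinuousMap.ext ha⟩

/-- Smallness of `p` and uniform smallness on `dominated p` control each other, and every member of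
the family lies in some `dominated p`. -/
theorem isInducing_gelfand : IsInducing A.gelfand := by
  rw [IsTopologicalAddGroup.isInducing_iff_nhds_zero]
  refine A.nhds_zero_hasBasis.ext ((FamilyCont.nhds_hasBasis 0).comap _) ?_ ?_
  · rintro ⟨p, r⟩ hr
    have hr2 : 0 < r / 2 := half_pos hr
    refine ⟨(Character.dominated p, r / 2), ⟨Character.dominated_mem_family p, hr2⟩, fun a ha => ?_⟩
    refine (Character.seminorm_le_of_forall_norm_le hr2.le fun χ hχ => ?_).trans_lt
      (half_lt_self hr)
    have := ha χ hχ
    change ‖χ a - 0‖ < r / 2 at this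
    rw [sub_zero] at this
    exact this.le
  · rintro ⟨K, ε⟩ ⟨⟨-, p, hp⟩, hε⟩
    refine ⟨(p, ε), hε, fun a ha (χ : A.Character) hχ => ?_⟩
    change ‖χ a - 0‖ < ε
    rw [sub_zero]
    exact (hp hχ a).trans_lt ha

/-- The Gelfand transform as an isomorphism of pro-C⋆-algebras. -/
noncomputable def gelfandIso : familyContFunctor.obj (Opposite.op A.characterSpace) ≅ A :=
  let e : A.carrier ≃⋆ₐ[ℂ] FamilyCont A.characterSpace :=
    StarAlgEquiv.ofBijective A.gelfand ⟨A.isInducing_gelfand.injective, A.gelfand_surjective⟩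
  { hom := Hom.mk (e.symm : FamilyCont A.characterSpace →⋆ₐ[ℂ] A.carrier) <|
      A.isInducing_gelfand.continuous_iff.mpr <| continuous_id.congr fun f =>
        (e.apply_symm_apply f).symm
    inv := Hom.mk A.gelfand A.isInducing_gelfand.continuous
    hom_inv_id := Hom.ext <| StarAlgHom.ext e.apply_symm_apply
    inv_hom_id := Hom.ext <| StarAlgHom.ext e.symm_apply_apply }

end

end CommProCStarAlg

instance : (familyContFunctor.{u}).EssSurj where
  mem_essImage A := ⟨_, ⟨A.gelfandIso⟩⟩

theorem mainTheorem6 :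
    (familyContFunctor.{u} : CategoryTheory.Functor FDTych.{u}ᵒᵖ CommProCStarAlg.{u}).IsEquivalence := by
  exact {}
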